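/- Let $d\in\mathbb N$. For positive definite complex $d\times d$ matrices $P,Q,R$ define the generalized fidelity $$F_R(P,Q):=\operatorname{Tr}\!\left[\bigl(R^{1/2}PR^{1/2}\bigr)^{1/2}R^{-1}\bigl(R^{1/2}QR^{1/2}\bigr)^{1/2}\right]\in\mathbb C,$$ and the Uhlmann fidelity $$F^{\mathrm U}(P,Q):=\operatorname{Tr}\!\left[\bigl(P^{1/2}QP^{1/2}\bigr)^{1/2}\right].$$ **Theorem.** Let $P,Q$ be positive definite complex $d\times d$ matrices. Then the functions $$\Phi_P(x):=F_{P^x}(P,Q),\qquad \Phi_Q(x):=F_{Q^x}(P,Q)\qquad(x\in\mathbb R)$$ are real-valued, and $F^{\mathrm U}(P,Q)$ is real. Both functions are nondecreasing on $(-\infty,1]$ and nonincreasing on $[1,\infty)$: for $y\le x\le 1$ one has $\Phi_P(y)\le\Phi_P(x)$ and $\Phi_Q(y)\le\Phi_Q(x)$, and for $1\le y\le x$ one has $\Phi_P(y)\ge\Phi_P(x)$ and $\Phi_Q(y)\ge\Phi_Q(x)$. Each attains its global maximum over $\mathbb R$ at $x=1$, that is, $\Phi_P(x)\le F^{\mathrm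 U}(P,Q)$ and $\Phi_Q(x)\le F^{\mathrm U}(P,Q)$ for all $x\in\mathbb R$, and $$\Phi_P(1)=\Phi_Q(1)=F^{\mathrm U}(P,Q).$$ -/

import Mathlib

open scoped ComplexOrder MatrixOrder

/-- The generalized fidelity
`F_R(P, Q) = Tr[(R^{1/2} P R^{1/2})^{1/2} R⁻¹ (R^{1/2} Q R^{1/2})^{1/2}]` with base `R`.
Real powers of matrices are those of the continuous functional calculus.
For general positive definite `P, Q, R` this trace is a complex number. -/
noncomputable def generalizedFidelity {d : ℕ} (R P Q : Matrix (Fin d) (Fin d) ℂ) : ℂ :=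
  (((R ^ (1 / 2 : ℝ) * P * R ^ (1 / 2 : ℝ)) ^ (1 / 2 : ℝ)) * R⁻¹ *
    ((R ^ (1 / 2 : ℝ) * Q * R ^ (1 / 2 : ℝ)) ^ (1 / 2 : ℝ))).trace

/-- The (unsquared) Uhlmann fidelity `F^U(P, Q) = Tr[(P^{1/2} Q P^{1/2})^{1/2}]`,
that is, the trace norm of `Q^{1/2} P^{1/2}`. -/
noncomputable def uhlmannFidelity {d : ℕ} (P Q : Matrix (Fin d) (Fin d) ℂ) : ℂ :=
  ((P ^ (1 / 2 : ℝ) * Q * P ^ (1 / 2 : ℝ)) ^ (1 / 2 : ℝ)).trace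

/-!
Since `P` commutes with `P^x`, the generalized fidelity with base `P^x` is
`g(x) = Tr[P^{(1-x)/2} H_x]`, where `H_x = (P^{x/2} Q P^{x/2})^{1/2}`; this is `polarFidelity P Q x`.
At `x = 1` it is the Uhlmann fidelity, so everything follows once `g'(x)` is known to have the sign
of `1 - x` (`exists_hasDerivAt_polarFidelity`).

Write `L = log P`, `F = P^{(1-x)/2}` and `H = H_x`. Differentiating `H² = P^{x/2} Q P^{x/2}` gives
`H' H + H H' = (L H² + H² L) / 2` (`hasDerivAt_sqrt`), so `H' = (L H + H L) / 2 - X`, where `X` is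
the solution of `H X + X H = H L H`, and `g'(x) = Tr(F L H) / 2 - Tr(F X)`. Let `L = ∑ l_a E_a` be
the spectral resolution, `F = ∑ f_a E_a`, and let `X_b` solve `H X_b + X_b H = H E_b H`. Solutions
of a Lyapunov equation with positive right-hand side are positive (`lyapunov_posSemidef`), so
`t_ab = Tr(E_a X_b) ≥ 0`; moreover `t` is symmetric and `∑_b X_b = H / 2`. Hence
`g'(x) = ∑ f_a (l_a - l_b) t_ab = (1/2) ∑ (f_a - f_b) (l_a - l_b) t_ab`
(`trace_lyapunov_nonneg`), and `f_a = exp((1-x) l_a / 2)` is ordered like `l_a` if `x ≤ 1` and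
oppositely if `x ≥ 1`.

The base `Q^x` gives the same function with the roles of `P` and `Q` exchanged, and the Uhlmann
fidelity is symmetric (`uhlmannFidelity_comm`).
-/

namespace PolarFidelity

open Matrix

variable {n : Type*} [Fintype n] [DecidableEq n]

/-! ### Lyapunov equations with positive definite coefficients -/

lemma trace_mul_nonneg {A B : Matrix n n ℂ} (hA : A.PosSemidef) (hB : B.PosSemidef) :
    0 ≤ (A * B).trace := by
  obtain ⟨C, rfl⟩ := CStarAlgebra.nonneg_iff_eq_star_mul_self.mp hA.nonneg
  rw [star_eq_conjTranspose, Matrix.mul_assoc, trace_mul_comm]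
  exact (hB.mul_mul_conjTranspose_same C).trace_nonneg

/-- The Sylvester operator `X ↦ A X + X B` with positive definite coefficients is injective:
if it kills `X`, then `Tr(X* A X) + Tr(X B X*) = 0`. -/
lemma sylvester_injective {A B X : Matrix n n ℂ} (hA : A.PosDef) (hB : B.PosDef)
    (h : A * X + X * B = 0) : X = 0 := by
  have h1 : 0 ≤ (Xᴴ * A * X).trace := (hA.posSemidef.conjTranspose_mul_mul_same X).trace_nonneg
  have h2 : 0 ≤ (X * B * Xᴴ).trace := (hB.posSemidef.mul_mul_conjTranspose_same X).trace_nonneg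
  have h3 : (Xᴴ * A * X).trace + (X * B * Xᴴ).trace = 0 := by
    rw [trace_mul_comm (X * B), Matrix.mul_assoc, ← trace_add, ← Matrix.mul_add, h,
      Matrix.mul_zero, trace_zero]
  -- two nonnegative traces with sum zero vanish
  have h4 : (Xᴴ * A * X).trace = 0 := le_antisymm (by
    rw [← h3]; exact le_add_of_nonneg_right h2) h1
  obtain ⟨C, hC⟩ := CStarAlgebra.nonneg_iff_eq_star_mul_self.mp hA.posSemidef.nonneg
  rw [star_eq_conjTranspose] at hC
  have h5 : C * X = 0 := by
    rw [← trace_conjTranspose_mul_self_eq_zero_iff, conjTranspose_mul, ← h4, hC]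
    simp only [Matrix.mul_assoc]
  have h6 : A * X = 0 := by rw [hC, Matrix.mul_assoc, h5, Matrix.mul_zero]
  exact hA.isUnit.mul_right_eq_zero.mp h6

lemma lyapunov_unique {H X Y : Matrix n n ℂ} (hH : H.PosDef)
    (h : H * X + X * H = H * Y + Y * H) : X = Y := by
  refine sub_eq_zero.mp (sylvester_injective hH hH ?_)
  rw [Matrix.mul_sub, Matrix.sub_mul, ← sub_eq_zero.mpr h]
  abel

/-- If `H` is positive definite, the solution of `H X + X H = Y ≥ 0` is positive: it is Hermitian
by uniqueness, and at an eigenvector `v` of `X` with eigenvalue `μ` one has `2 μ ⟨v, H v⟩ = ⟨v, Y v⟩ ≥ 0`. -/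
lemma lyapunov_posSemidef {H X Y : Matrix n n ℂ} (hH : H.PosDef) (hY : Y.PosSemidef)
    (h : H * X + X * H = Y) : X.PosSemidef := by
  have hX : X.IsHermitian := by
    refine lyapunov_unique hH ?_
    rw [h]
    have := congrArg conjTranspose h
    rw [conjTranspose_add, conjTranspose_mul, conjTranspose_mul, hH.isHermitian.eq,
      hY.isHermitian.eq] at this
    rw [← this, add_comm]
  rw [hX.posSemidef_iff_eigenvalues_nonneg]
  intro i
  set v : n → ℂ := ⇑(hX.eigenvectorBasis i) with hv
  have hXv : X *ᵥ v = hX.eigenvalues i • v := hX.mulVec_eigenvectorBasis i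
  have hv0 : v ≠ 0 := by
    intro h0
    exact hX.eigenvectorBasis.orthonormal.ne_zero i (by ext j; exact congrFun h0 j)
  have hvX : star v ᵥ* X = hX.eigenvalues i • star v := by
    have := congrArg star hXv
    rw [star_mulVec, hX.eq] at this
    rw [this]
    ext j
    simp
  have hpos := hH.dotProduct_mulVec_pos hv0
  have hnn := hY.dotProduct_mulVec_nonneg v
  have key : star v ⬝ᵥ Y *ᵥ v = ((2 * hX.eigenvalues i : ℝ) : ℂ) * (star v ⬝ᵥ H *ᵥ v) := by
    rw [← h, Matrix.add_mulVec, dotProduct_add, ← mulVec_mulVec, ← mulVec_mulVec, hXv,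
      mulVec_smul, dotProduct_smul, dotProduct_mulVec _ X, hvX, smul_dotProduct]
    simp only [Complex.real_smul]
    push_cast
    ring
  rw [key] at hnn
  by_contra hneg
  have hlt : hX.eigenvalues i < 0 := not_le.mp hneg
  have h7 : ((2 * hX.eigenvalues i : ℝ) : ℂ) < 0 := by
    rw [← Complex.ofReal_zero, Complex.real_lt_real]; linarith
  exact absurd hnn (not_le_of_gt (mul_neg_of_neg_of_pos h7 hpos))

lemma exists_lyapunov {H : Matrix n n ℂ} (hH : H.PosDef) (Y : Matrix n n ℂ) :
    ∃ X, H * X + X * H = Y := by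
  let T : Matrix n n ℂ →ₗ[ℂ] Matrix n n ℂ := LinearMap.mulLeft ℂ H + LinearMap.mulRight ℂ H
  have hT : Function.Injective T := fun X Z hXZ => lyapunov_unique hH hXZ
  exact LinearMap.injective_iff_surjective.mp hT Y

lemma sum_smul_mul_sum_smul {E : n → Matrix n n ℂ}
    (hEE : ∀ a b, E a * E b = if a = b then E a else 0) (f g : n → ℝ) :
    (∑ a, (f a : ℂ) • E a) * (∑ a, (g a : ℂ) • E a) = ∑ a, ((f a * g a : ℝ) : ℂ) • E a := by
  rw [Matrix.sum_mul]
  refine Finset.sum_congr rfl fun a _ => ?_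
  rw [Matrix.mul_sum, Finset.sum_eq_single a]
  · rw [Matrix.smul_mul, Matrix.mul_smul, hEE, if_pos rfl, smul_smul, Complex.ofReal_mul]
  · intro b _ hb
    rw [Matrix.smul_mul, Matrix.mul_smul, hEE, if_neg hb.symm, smul_zero, smul_zero]
  · simp

/-- The sign of the derivative of `polarFidelity`, in algebraic form: `L = ∑ l_a E_a` and
`F = ∑ f_a E_a` stand for `log P` and `P^{(1-x)/2}`, and `N` for the derivative of `H`. With
`X_b ≥ 0` the solution of `H X + X H = H E_b H` and `t_ab = Tr(E_a X_b) ≥ 0`, which is symmetric,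
the trace equals `∑ f_a (l_a - l_b) t_ab = 1/2 ∑ (f_a - f_b) (l_a - l_b) t_ab`. -/
lemma trace_lyapunov_nonneg {H N : Matrix n n ℂ} (hH : H.PosDef) {E : n → Matrix n n ℂ}
    (hE : ∀ a, (E a).PosSemidef) (hE1 : ∑ a, E a = 1)
    (hEE : ∀ a b, E a * E b = if a = b then E a else 0)
    (f l : n → ℝ) (hfl : ∀ a b, 0 ≤ (f a - f b) * (l a - l b))
    (hN : H * N + N * H = (1 / 2 : ℂ) •
      ((∑ a, (l a : ℂ) • E a) * (H * H) + (H * H) * ∑ a, (l a : ℂ) • E a)) :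
    0 ≤ ((∑ a, (f a : ℂ) • E a) * N -
      (1 / 2 : ℂ) • ((∑ a, (f a : ℂ) • E a) * (∑ a, (l a : ℂ) • E a) * H)).trace := by
  choose X hX using fun b => exists_lyapunov hH (H * E b * H)
  have hXpos : ∀ b, (X b).PosSemidef := fun b => lyapunov_posSemidef hH
    (by simpa [hH.isHermitian.eq] using (hE b).mul_mul_conjTranspose_same H) (hX b)
  have hXsum : ∑ b, X b = (1 / 2 : ℂ) • H := by
    refine lyapunov_unique hH ?_
    rw [Matrix.mul_sum, Matrix.sum_mul, ← Finset.sum_add_distrib]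
    simp only [hX]
    rw [← Matrix.sum_mul, ← Matrix.mul_sum, hE1, Matrix.mul_one, Matrix.mul_smul, Matrix.smul_mul,
      ← add_smul]
    norm_num
  set L : Matrix n n ℂ := ∑ a, (l a : ℂ) • E a with hL
  set F : Matrix n n ℂ := ∑ a, (f a : ℂ) • E a with hF
  have hN' : N = (1 / 2 : ℂ) • (L * H + H * L) - ∑ b, (l b : ℂ) • X b := by
    refine lyapunov_unique hH ?_
    have h1 : H * (∑ b, (l b : ℂ) • X b) + (∑ b, (l b : ℂ) • X b) * H = H * L * H := by
      rw [hL, Matrix.mul_sum, Matrix.sum_mul, Matrix.mul_sum, Matrix.sum_mul,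
        ← Finset.sum_add_distrib]
      refine Finset.sum_congr rfl fun b _ => ?_
      rw [Matrix.mul_smul, Matrix.smul_mul, ← smul_add, hX, Matrix.mul_smul, Matrix.smul_mul]
    rw [hN]
    calc _ = (1 / 2 : ℂ) • (L * (H * H) + H * H * L) + H * L * H - H * L * H := by abel
      _ = _ := by
        nth_rewrite 2 [← h1]
        have : H * L * H = (1 / 2 : ℂ) • (H * L * H + H * L * H) := by
          rw [← two_smul ℂ, smul_smul]; norm_num
        rw [this]
        simp only [Matrix.mul_sub, Matrix.sub_mul, Matrix.mul_smul, Matrix.smul_mul,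
          Matrix.mul_add, Matrix.add_mul, Matrix.mul_assoc, smul_add]
        abel
  have hFL : F * L = L * F := by
    rw [hF, hL, sum_smul_mul_sum_smul hEE, sum_smul_mul_sum_smul hEE]
    simp only [mul_comm]
  -- dividing the equation of `X a` by `H` on both sides makes the symmetry of `t` visible
  have hEa : ∀ a, E a = X a * H⁻¹ + H⁻¹ * X a := by
    intro a
    have hu := (Matrix.isUnit_iff_isUnit_det H).mp hH.isUnit
    have := congrArg (fun Z => H⁻¹ * Z * H⁻¹) (hX a)
    simp only [Matrix.mul_add, Matrix.add_mul, ← Matrix.mul_assoc] at this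
    simpa [Matrix.mul_assoc, Matrix.nonsing_inv_mul _ hu, Matrix.mul_nonsing_inv _ hu,
      Matrix.nonsing_inv_mul_cancel_left _ _ hu] using this.symm
  set t : n → n → ℂ := fun a b => (E a * X b).trace with ht
  have htpos : ∀ a b, 0 ≤ t a b := fun a b => trace_mul_nonneg (hE a) (hXpos b)
  have htsymm : ∀ a b, t a b = t b a := by
    intro a b
    simp only [ht]
    rw [hEa a, hEa b, Matrix.add_mul, Matrix.add_mul, trace_add, trace_add, add_comm]
    congr 1
    · rw [trace_mul_cycle, trace_mul_cycle]
    · rw [Matrix.mul_assoc, trace_mul_comm]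
  have htsum : ∀ a, (E a * H).trace = 2 * ∑ b, t a b := by
    intro a
    simp only [ht]
    rw [← trace_sum, ← Matrix.mul_sum, hXsum, Matrix.mul_smul, trace_smul, smul_eq_mul]
    ring
  have h1 : (F * N - (1 / 2 : ℂ) • (F * L * H)).trace =
      ∑ a, ∑ b, ((f a * (l a - l b) : ℝ) : ℂ) * t a b := by
    have e1 : (F * (H * L)).trace = (F * L * H).trace := by
      rw [← Matrix.mul_assoc, trace_mul_comm, ← Matrix.mul_assoc, hFL]
    have e2 : (F * L * H).trace = ∑ a, ∑ b, 2 * ((f a * l a : ℝ) : ℂ) * t a b := by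
      rw [hF, hL, sum_smul_mul_sum_smul hEE, Matrix.sum_mul, trace_sum]
      refine Finset.sum_congr rfl fun a _ => ?_
      rw [Matrix.smul_mul, trace_smul, htsum, smul_eq_mul, ← Finset.mul_sum]
      push_cast; ring
    have e3 : (F * ∑ b, (l b : ℂ) • X b).trace = ∑ a, ∑ b, ((f a * l b : ℝ) : ℂ) * t a b := by
      rw [hF, Matrix.sum_mul, trace_sum]
      refine Finset.sum_congr rfl fun a _ => ?_
      rw [Matrix.mul_sum, trace_sum]
      refine Finset.sum_congr rfl fun b _ => ?_
      simp only [Matrix.smul_mul, Matrix.mul_smul, trace_smul, smul_eq_mul, ht]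
      push_cast; ring
    rw [hN', Matrix.mul_sub, Matrix.mul_smul, Matrix.mul_add, trace_sub, trace_sub, trace_smul,
      trace_smul, trace_add, e1, ← Matrix.mul_assoc, e3]
    have : (1 / 2 : ℂ) • ((F * L * H).trace + (F * L * H).trace) = (F * L * H).trace := by
      rw [smul_eq_mul]; ring
    rw [this, e2, smul_eq_mul, Finset.mul_sum, ← Finset.sum_sub_distrib, ← Finset.sum_sub_distrib]
    refine Finset.sum_congr rfl fun a _ => ?_
    rw [Finset.mul_sum, ← Finset.sum_sub_distrib, ← Finset.sum_sub_distrib]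
    refine Finset.sum_congr rfl fun b _ => ?_
    push_cast; ring
  -- symmetrise the double sum in `a` and `b`
  have h2 : (∑ a, ∑ b, ((f a * (l a - l b) : ℝ) : ℂ) * t a b) =
      (1 / 2 : ℂ) * ∑ a, ∑ b, (((f a - f b) * (l a - l b) : ℝ) : ℂ) * t a b := by
    have h3 : (∑ a, ∑ b, ((f a * (l a - l b) : ℝ) : ℂ) * t a b) =
        ∑ a, ∑ b, ((f b * (l b - l a) : ℝ) : ℂ) * t a b := by
      rw [Finset.sum_comm]
      exact Finset.sum_congr rfl fun a _ => Finset.sum_congr rfl fun b _ => by rw [htsymm]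
    have h4 : (∑ a, ∑ b, (((f a - f b) * (l a - l b) : ℝ) : ℂ) * t a b) =
        (∑ a, ∑ b, ((f a * (l a - l b) : ℝ) : ℂ) * t a b) +
        ∑ a, ∑ b, ((f b * (l b - l a) : ℝ) : ℂ) * t a b := by
      simp only [← Finset.sum_add_distrib, ← add_mul, ← Complex.ofReal_add]
      refine Finset.sum_congr rfl fun a _ => Finset.sum_congr rfl fun b _ => ?_
      congr 2; ring
    rw [h4, ← h3]; ring
  rw [h1, h2]
  refine mul_nonneg (by simp) (Finset.sum_nonneg fun a _ => Finset.sum_nonneg fun b _ =>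
    mul_nonneg ?_ (htpos a b))
  exact_mod_cast hfl a b

/-! ### Real powers of positive definite matrices -/

/-- The powers of `P` in terms of its eigenvalues `p` and the rank-one projections `E` onto an
orthonormal eigenbasis. -/
lemma exists_spectral_resolution {P : Matrix n n ℂ} (hP : P.PosDef) :
    ∃ (p : n → ℝ) (E : n → Matrix n n ℂ), (∀ a, 0 < p a) ∧ (∀ a, (E a).PosSemidef) ∧
      ∑ a, E a = 1 ∧ (∀ a b, E a * E b = if a = b then E a else 0) ∧
      ∀ x : ℝ, P ^ x = ∑ a, ((p a ^ x : ℝ) : ℂ) • E a := by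
  set U : Matrix n n ℂ := (hP.isHermitian.eigenvectorUnitary : Matrix n n ℂ) with hU
  have hU1 : Uᴴ * U = 1 := Unitary.coe_star_mul_self hP.isHermitian.eigenvectorUnitary
  have hU2 : U * Uᴴ = 1 := Unitary.coe_mul_star_self hP.isHermitian.eigenvectorUnitary
  refine ⟨hP.isHermitian.eigenvalues, fun a => U * diagonal (Pi.single a 1) * Uᴴ,
    hP.eigenvalues_pos, fun a => ?_, ?_, fun a b => ?_, fun x => ?_⟩
  · refine PosSemidef.mul_mul_conjTranspose_same (PosSemidef.diagonal fun i => ?_) U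
    by_cases h : i = a
    · subst h; simp
    · simp [h]
  · rw [← Matrix.sum_mul, ← Matrix.mul_sum]
    have : ∑ a, diagonal (Pi.single a (1 : ℂ)) = (1 : Matrix n n ℂ) := by
      ext i j
      simp [Matrix.sum_apply, diagonal_apply, Matrix.one_apply, Pi.single_apply]
    rw [this, Matrix.mul_one, hU2]
  · calc _ = U * diagonal (Pi.single a 1) * (Uᴴ * U) * diagonal (Pi.single b 1) * Uᴴ := by
          simp only [Matrix.mul_assoc]
      _ = U * (diagonal (Pi.single a 1) * diagonal (Pi.single b 1)) * Uᴴ := by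
          rw [hU1]; simp only [Matrix.mul_assoc, Matrix.one_mul]
      _ = _ := by
          split_ifs with h
          · subst h
            congr 2
            rw [diagonal_mul_diagonal]
            congr 1
            ext i
            by_cases h : i = a
            · subst h; simp
            · simp [h]
          · have : (diagonal (Pi.single a 1) * diagonal (Pi.single b 1) : Matrix n n ℂ) = 0 := by
              rw [diagonal_mul_diagonal, ← diagonal_zero]
              congr 1
              ext i
              by_cases h' : i = a
              · subst h'; simp [h]
              · simp [h']
            rw [this, Matrix.mul_zero, Matrix.zero_mul]
  · rw [CFC.rpow_eq_cfc_real (ha := hP.posSemidef.nonneg), hP.isHermitian.cfc_eq,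
      IsHermitian.cfc, Unitary.conjStarAlgAut_apply]
    change U * _ * Uᴴ = _
    have h : ∀ (c : ℂ) (D : Matrix n n ℂ), c • (U * D * Uᴴ) = U * (c • D) * Uᴴ := fun c D => by
      rw [Matrix.mul_smul, Matrix.smul_mul]
    simp only [h]
    rw [← Matrix.sum_mul, ← Matrix.mul_sum]
    congr 2
    ext i j
    simp [Matrix.sum_apply, diagonal_apply, Pi.single_apply]

lemma posDef_rpow {P : Matrix n n ℂ} (hP : P.PosDef) (x : ℝ) : (P ^ x).PosDef := by
  have h : (P ^ x).PosSemidef := (CFC.rpow_nonneg (a := P) (y := x)).posSemidef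
  exact h.posDef_iff_isUnit.mpr (hP.isUnit.cfcRpow x hP.posSemidef.nonneg)

lemma posDef_sqrt {P : Matrix n n ℂ} (hP : P.PosDef) : (CFC.sqrt P).PosDef := by
  rw [CFC.sqrt_eq_rpow]; exact posDef_rpow hP _

lemma posDef_mul_mul_same {A Q : Matrix n n ℂ} (hA : A.PosDef) (hQ : Q.PosDef) :
    (A * Q * A).PosDef := by
  have := hQ.mul_mul_conjTranspose_same (B := A) (Matrix.vecMul_injective_iff_isUnit.mpr hA.isUnit)
  rwa [hA.isHermitian.eq] at this

/-- The function `x ↦ Tr[P^{(1-x)/2} (P^{x/2} Q P^{x/2})^{1/2}]`, which is `F_{P^x}(P, Q)`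
(`generalizedFidelity_rpow_left`). -/
noncomputable def polarFidelity (P Q : Matrix n n ℂ) (x : ℝ) : ℂ :=
  (P ^ ((1 - x) / 2) * CFC.sqrt (P ^ (x / 2) * Q * P ^ (x / 2))).trace

/-! ### Monotonicity through the derivative -/

section Derivative

open scoped Matrix.Norms.L2Operator
open Topology Filter

/-- The square root is differentiable along a differentiable curve `M` of positive definite
matrices. The difference quotient `D` of `√M` between `x` and `t` solves the Sylvester equation
`√(M t) D + D √(M x) = (M t - M x) / (t - x)`, whose operator is invertible and continuous in
`t`. -/
lemma hasDerivAt_sqrt {M : ℝ → Matrix n n ℂ} {M' : Matrix n n ℂ} {x : ℝ}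
    (hpos : ∀ t, (M t).PosDef) (hM : HasDerivAt M M' x) :
    ∃ N, HasDerivAt (fun t => CFC.sqrt (M t)) N x ∧
      CFC.sqrt (M x) * N + N * CFC.sqrt (M x) = M' := by
  set H : ℝ → Matrix n n ℂ := fun t => CFC.sqrt (M t) with hH
  have hHpos : ∀ t, (H t).PosDef := fun t => posDef_sqrt (hpos t)
  have hHM : ∀ t, H t * H t = M t := fun t => CFC.sqrt_mul_sqrt_self _ (hpos t).posSemidef.nonneg
  have hHc : ContinuousAt H x := by
    have h1 : ContinuousWithinAt CFC.sqrt {A : Matrix n n ℂ | 0 ≤ A} (M x) :=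
      CFC.continuousOn_sqrt (M x) (hpos x).posSemidef.nonneg
    have h2 : Tendsto M (𝓝 x) (𝓝[{A : Matrix n n ℂ | 0 ≤ A}] (M x)) :=
      tendsto_nhdsWithin_iff.mpr ⟨hM.continuousAt,
        Eventually.of_forall fun t => (hpos t).posSemidef.nonneg⟩
    exact h1.tendsto.comp h2
  let T : ℝ → (Matrix n n ℂ →L[ℝ] Matrix n n ℂ) := fun t =>
    ContinuousLinearMap.mul ℝ (Matrix n n ℂ) (H t) +
      (ContinuousLinearMap.mul ℝ (Matrix n n ℂ)).flip (H x)
  have hT : ∀ t X, T t X = H t * X + X * H x := fun t X => rfl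
  have hTu : ∀ t, IsUnit (T t) := by
    intro t
    have hinj : Function.Injective (T t) := by
      rw [injective_iff_map_eq_zero]
      exact fun X hX => sylvester_injective (hHpos t) (hHpos x) hX
    exact ContinuousLinearMap.isUnit_iff_bijective.mpr
      ⟨hinj, (LinearMap.injective_iff_surjective (f := (T t).toLinearMap)).mp hinj⟩
  have hTc : ContinuousAt T x :=
    ((ContinuousLinearMap.mul ℝ (Matrix n n ℂ)).continuous.continuousAt.comp hHc).add
      continuousAt_const
  have hTinv : Tendsto (fun t => Ring.inverse (T t)) (𝓝 x) (𝓝 (Ring.inverse (T x))) := by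
    have := NormedRing.inverse_continuousAt (R := Matrix n n ℂ →L[ℝ] Matrix n n ℂ) (hTu x).unit
    exact this.tendsto.comp hTc
  have hslope : ∀ t, Ring.inverse (T t) (slope M x t) = slope H x t := by
    intro t
    have h1 : slope M x t = T t (slope H x t) := by
      rw [hT, slope_def_module, slope_def_module, ← hHM t, ← hHM x, mul_smul_comm,
        smul_mul_assoc, ← smul_add]
      congr 1
      noncomm_ring
    rw [h1, ← mul_apply_eq_comp, Ring.inverse_mul_cancel _ (hTu t)]
    rfl
  refine ⟨Ring.inverse (T x) M', ?_, ?_⟩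
  · rw [hasDerivAt_iff_tendsto_slope] at hM ⊢
    have h1 := ((isBoundedBilinearMap_apply (𝕜 := ℝ)).continuous.tendsto _).comp
      ((hTinv.mono_left nhdsWithin_le_nhds).prodMk_nhds hM)
    simpa only [Function.comp_def, hslope] using h1
  · change T x (Ring.inverse (T x) M') = M'
    rw [← mul_apply_eq_comp, Ring.mul_inverse_cancel _ (hTu x)]
    rfl

lemma hasDerivAt_sum_rpow_smul {p : n → ℝ} (hp : ∀ a, 0 < p a) (E : n → Matrix n n ℂ)
    {u : ℝ → ℝ} {u' x : ℝ} (hu : HasDerivAt u u' x) :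
    HasDerivAt (fun t => ∑ a, ((p a ^ u t : ℝ) : ℂ) • E a)
      ((u' : ℂ) • ∑ a, ((Real.log (p a) * p a ^ u x : ℝ) : ℂ) • E a) x := by
  rw [Finset.smul_sum]
  refine HasDerivAt.fun_sum fun a _ => ?_
  rw [smul_smul]
  have h := (hu.const_rpow (hp a)).ofReal_comp.smul_const (E a)
  convert h using 2
  push_cast; ring

/-- The derivative of `polarFidelity P Q` at `x` has the sign of `1 - x`. -/
lemma exists_hasDerivAt_polarFidelity {P Q : Matrix n n ℂ} (hP : P.PosDef) (hQ : Q.PosDef)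
    (x : ℝ) : ∃ g' : ℝ, HasDerivAt (fun t => (polarFidelity P Q t).re) g' x ∧
      (x ≤ 1 → 0 ≤ g') ∧ (1 ≤ x → g' ≤ 0) := by
  obtain ⟨p, E, hp, hE, hE1, hEE, hPE⟩ := exists_spectral_resolution hP
  set l : n → ℝ := fun a => Real.log (p a) with hl
  set L : Matrix n n ℂ := ∑ a, (l a : ℂ) • E a with hL
  have hrpow : ∀ {u : ℝ → ℝ} {u' : ℝ}, HasDerivAt u u' x →
      HasDerivAt (fun t => P ^ u t) ((u' : ℂ) • (L * P ^ u x)) x := by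
    intro u u' hu
    simp only [hPE]
    rw [hL, sum_smul_mul_sum_smul hEE]
    exact hasDerivAt_sum_rpow_smul hp E hu
  have hcomm : ∀ y : ℝ, L * P ^ y = P ^ y * L := by
    intro y
    rw [hPE, hL, sum_smul_mul_sum_smul hEE, sum_smul_mul_sum_smul hEE]
    simp only [mul_comm]
  have hA : HasDerivAt (fun t : ℝ => P ^ (t / 2)) (((1 / 2 : ℝ) : ℂ) • (L * P ^ (x / 2))) x :=
    hrpow ((hasDerivAt_id x).div_const 2)
  have hF : HasDerivAt (fun t : ℝ => P ^ ((1 - t) / 2))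
      (((-1 / 2 : ℝ) : ℂ) • (L * P ^ ((1 - x) / 2))) x :=
    hrpow (((hasDerivAt_id x).const_sub 1).div_const 2)
  have hMpos : ∀ t : ℝ, (P ^ (t / 2) * Q * P ^ (t / 2)).PosDef := fun t =>
    posDef_mul_mul_same (posDef_rpow hP _) hQ
  obtain ⟨N, hN, hNeq⟩ := hasDerivAt_sqrt hMpos ((hA.mul_const Q).mul hA)
  set H : Matrix n n ℂ := CFC.sqrt (P ^ (x / 2) * Q * P ^ (x / 2)) with hH
  have hHpos : H.PosDef := posDef_sqrt (hMpos x)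
  have hHH : H * H = P ^ (x / 2) * Q * P ^ (x / 2) :=
    CFC.sqrt_mul_sqrt_self _ (hMpos x).posSemidef.nonneg
  have hNeq' : H * N + N * H = (1 / 2 : ℂ) • (L * (H * H) + (H * H) * L) := by
    rw [hNeq, hHH, Matrix.mul_assoc _ _ L, ← hcomm]
    simp only [Matrix.smul_mul, Matrix.mul_smul, smul_add, Matrix.mul_assoc]
    norm_num
  let τ : Matrix n n ℂ →L[ℝ] ℝ := LinearMap.toContinuousLinearMap
    (Complex.reLm ∘ₗ (Matrix.traceLinearMap n ℝ ℂ))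
  have hder := τ.hasFDerivAt.comp_hasDerivAt x (hF.mul hN)
  have hFN : P ^ ((1 - x) / 2) * N - (1 / 2 : ℂ) • (P ^ ((1 - x) / 2) * L * H) =
      ((-1 / 2 : ℝ) : ℂ) • (L * P ^ ((1 - x) / 2)) * H + P ^ ((1 - x) / 2) * N := by
    rw [hcomm, Matrix.smul_mul, sub_eq_add_neg, ← neg_smul, add_comm]
    norm_num
  have hmono : ∀ (s : ℝ) (a b : n), 0 ≤ s → 0 ≤ (p a ^ s - p b ^ s) * (l a - l b) := by
    intro s a b hs
    rcases le_total (p a) (p b) with h | h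
    · exact mul_nonneg_of_nonpos_of_nonpos
        (sub_nonpos.mpr (Real.rpow_le_rpow (hp a).le h hs))
        (sub_nonpos.mpr (Real.log_le_log (hp a) h))
    · exact mul_nonneg (sub_nonneg.mpr (Real.rpow_le_rpow (hp b).le h hs))
        (sub_nonneg.mpr (Real.log_le_log (hp b) h))
  have hanti : ∀ (s : ℝ) (a b : n), s ≤ 0 → 0 ≤ (-p a ^ s - -p b ^ s) * (l a - l b) := by
    intro s a b hs
    rcases le_total (p a) (p b) with h | h
    · exact mul_nonneg_of_nonpos_of_nonpos
        (by linarith [Real.rpow_le_rpow_of_nonpos (hp a) h hs])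
        (sub_nonpos.mpr (Real.log_le_log (hp a) h))
    · exact mul_nonneg (by linarith [Real.rpow_le_rpow_of_nonpos (hp b) h hs])
        (sub_nonneg.mpr (Real.log_le_log (hp b) h))
  refine ⟨_, hder, fun hx => ?_, fun hx => ?_⟩
  · have h := trace_lyapunov_nonneg hHpos hE hE1 hEE (fun a => p a ^ ((1 - x) / 2)) l
      (fun a b => hmono _ a b (by linarith)) hNeq'
    rw [← hPE, ← hL, hFN] at h
    exact (Complex.le_def.mp h).1
  -- for `x ≥ 1` the negative of `P^{(1-x)/2}` is ordered like `log P`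
  · have h := trace_lyapunov_nonneg hHpos hE hE1 hEE (fun a => -p a ^ ((1 - x) / 2)) l
      (fun a b => hanti _ a b (by linarith)) hNeq'
    simp only [Complex.ofReal_neg, neg_smul, Finset.sum_neg_distrib, Matrix.neg_mul, smul_neg]
      at h
    rw [← hPE, ← hL, sub_neg_eq_add, neg_add_eq_sub, ← neg_sub, hFN, trace_neg] at h
    exact neg_nonneg.mp (Complex.le_def.mp h).1

lemma monotoneOn_polarFidelity {P Q : Matrix n n ℂ} (hP : P.PosDef) (hQ : Q.PosDef) :
    MonotoneOn (fun x => (polarFidelity P Q x).re) (Set.Iic 1) := by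
  choose g' hg' hpos _ using exists_hasDerivAt_polarFidelity hP hQ
  refine monotoneOn_of_hasDerivWithinAt_nonneg (f' := g') (convex_Iic 1)
    (fun x _ => (hg' x).continuousAt.continuousWithinAt)
    (fun x _ => (hg' x).hasDerivWithinAt) fun x hx => hpos x ?_
  exact Set.mem_Iic.mp (interior_subset hx)

lemma antitoneOn_polarFidelity {P Q : Matrix n n ℂ} (hP : P.PosDef) (hQ : Q.PosDef) :
    AntitoneOn (fun x => (polarFidelity P Q x).re) (Set.Ici 1) := by
  choose g' hg' _ hneg using exists_hasDerivAt_polarFidelity hP hQ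
  refine antitoneOn_of_hasDerivWithinAt_nonpos (f' := g') (convex_Ici 1)
    (fun x _ => (hg' x).continuousAt.continuousWithinAt)
    (fun x _ => (hg' x).hasDerivWithinAt) fun x hx => hneg x ?_
  exact Set.mem_Ici.mp (interior_subset hx)

end Derivative

/-! ### The fidelities -/

lemma inv_rpow_eq_rpow_neg {P : Matrix n n ℂ} (hP : P.PosDef) (x : ℝ) :
    (P ^ x)⁻¹ = P ^ (-x) := by
  refine Matrix.inv_eq_left_inv ?_
  exact CFC.rpow_neg_mul_rpow x hP.isStrictlyPositive

lemma sqrt_rpow_mul_self_mul_rpow {P : Matrix n n ℂ} (hP : P.PosDef) (x : ℝ) :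
    CFC.sqrt (P ^ (x / 2) * P * P ^ (x / 2)) = P ^ ((1 + x) / 2) := by
  refine CFC.sqrt_unique ?_ CFC.rpow_nonneg
  have h1 : P ^ (x / 2) * P * P ^ (x / 2) = P ^ (x / 2) * P ^ (1 : ℝ) * P ^ (x / 2) := by
    rw [CFC.rpow_one P hP.posSemidef.nonneg]
  rw [h1, ← CFC.rpow_add hP.isUnit, ← CFC.rpow_add hP.isUnit, ← CFC.rpow_add hP.isUnit]
  congr 1
  ring

lemma rpow_half_rpow {P : Matrix n n ℂ} (hP : P.PosDef) (x : ℝ) :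
    (P ^ x) ^ (1 / 2 : ℝ) = P ^ (x / 2) := by
  rw [← CFC.sqrt_eq_rpow]
  refine CFC.sqrt_unique ?_ CFC.rpow_nonneg
  rw [← CFC.rpow_add hP.isUnit, add_halves]

lemma generalizedFidelity_rpow_left {d : ℕ} {P Q : Matrix (Fin d) (Fin d) ℂ} (hP : P.PosDef)
    (x : ℝ) : generalizedFidelity (P ^ x) P Q = polarFidelity P Q x := by
  rw [generalizedFidelity, polarFidelity, rpow_half_rpow hP, ← CFC.sqrt_eq_rpow,
    ← CFC.sqrt_eq_rpow, sqrt_rpow_mul_self_mul_rpow hP, inv_rpow_eq_rpow_neg hP,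
    ← CFC.rpow_add hP.isUnit]
  congr 4
  ring

lemma generalizedFidelity_rpow_right {d : ℕ} {P Q : Matrix (Fin d) (Fin d) ℂ} (hQ : Q.PosDef)
    (x : ℝ) : generalizedFidelity (Q ^ x) P Q = polarFidelity Q P x := by
  rw [generalizedFidelity, polarFidelity, rpow_half_rpow hQ, ← CFC.sqrt_eq_rpow,
    ← CFC.sqrt_eq_rpow, sqrt_rpow_mul_self_mul_rpow hQ, inv_rpow_eq_rpow_neg hQ,
    Matrix.mul_assoc, ← CFC.rpow_add hQ.isUnit, trace_mul_comm]
  congr 3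
  ring

lemma polarFidelity_one {d : ℕ} {P Q : Matrix (Fin d) (Fin d) ℂ} (hP : P.PosDef) :
    polarFidelity P Q 1 = uhlmannFidelity P Q := by
  rw [polarFidelity, uhlmannFidelity, ← CFC.sqrt_eq_rpow (a := _ * _ * _), sub_self, zero_div,
    CFC.rpow_zero P hP.posSemidef.nonneg, Matrix.one_mul]

lemma im_trace_mul_eq_zero {m : Type*} [Fintype m] {A B : Matrix m m ℂ}
    (hA : A.IsHermitian) (hB : B.IsHermitian) :
    (A * B).trace.im = 0 := by
  have h : star (A * B).trace = (A * B).trace := by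
    rw [← trace_conjTranspose, conjTranspose_mul, hA.eq, hB.eq, trace_mul_comm]
  exact Complex.conj_eq_iff_im.mp h

lemma im_polarFidelity (P Q : Matrix n n ℂ) (x : ℝ) : (polarFidelity P Q x).im = 0 :=
  im_trace_mul_eq_zero (CFC.rpow_nonneg (a := P)).posSemidef.isHermitian
    (CFC.sqrt_nonneg _).posSemidef.isHermitian

/-- With `Y = Q^{1/2} P^{1/2}`, the two sides are the traces of `|Y|` and of
`|Y*| = Y |Y|⁻¹ Y*`. -/
lemma uhlmannFidelity_comm {d : ℕ} {P Q : Matrix (Fin d) (Fin d) ℂ} (hP : P.PosDef)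
    (hQ : Q.PosDef) : uhlmannFidelity P Q = uhlmannFidelity Q P := by
  rw [uhlmannFidelity, uhlmannFidelity, ← CFC.sqrt_eq_rpow (a := _ * _ * _),
    ← CFC.sqrt_eq_rpow (a := _ * _ * _)]
  set A := P ^ (1 / 2 : ℝ) with hA
  set B := Q ^ (1 / 2 : ℝ) with hB
  have hApos : A.PosDef := posDef_rpow hP _
  have hBpos : B.PosDef := posDef_rpow hQ _
  have hAA : A * A = P := by
    rw [hA, ← CFC.rpow_add hP.isUnit, add_halves, CFC.rpow_one P hP.posSemidef.nonneg]
  have hBB : B * B = Q := by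
    rw [hB, ← CFC.rpow_add hQ.isUnit, add_halves, CFC.rpow_one Q hQ.posSemidef.nonneg]
  have hM : (A * Q * A).PosDef := posDef_mul_mul_same hApos hQ
  set H := CFC.sqrt (A * Q * A) with hH
  have hHpos : H.PosDef := posDef_sqrt hM
  have hHu := (Matrix.isUnit_iff_isUnit_det H).mp hHpos.isUnit
  have hHH : H * H = A * (B * B) * A := by
    rw [hBB]; exact CFC.sqrt_mul_sqrt_self _ hM.posSemidef.nonneg
  have hY : CFC.sqrt (B * P * B) = B * A * H⁻¹ * (A * B) := by
    refine CFC.sqrt_unique ?_ ?_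
    · calc _ = B * A * H⁻¹ * (A * (B * B) * A) * H⁻¹ * (A * B) := by
            simp only [Matrix.mul_assoc]
        _ = B * (A * A) * B := by
            rw [← hHH, ← Matrix.mul_assoc (B * A * H⁻¹) H H,
              Matrix.nonsing_inv_mul_cancel_right _ _ hHu,
              Matrix.mul_nonsing_inv_cancel_right _ _ hHu]
            simp only [Matrix.mul_assoc]
        _ = _ := by rw [hAA]
    · have := hHpos.posSemidef.inv.mul_mul_conjTranspose_same (B * A)
      rw [conjTranspose_mul, hApos.isHermitian.eq, hBpos.isHermitian.eq] at this
      exact this.nonneg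
  rw [hY, Matrix.mul_assoc, trace_mul_comm]
  have : H⁻¹ * (A * B) * (B * A) = H := by
    calc _ = H⁻¹ * (A * (B * B) * A) := by simp only [Matrix.mul_assoc]
      _ = H := by rw [← hHH, Matrix.nonsing_inv_mul_cancel_left _ _ hHu]
  rw [this]

lemma re_polarFidelity_le_one {P Q : Matrix n n ℂ} (hP : P.PosDef) (hQ : Q.PosDef) (x : ℝ) :
    (polarFidelity P Q x).re ≤ (polarFidelity P Q 1).re := by
  rcases le_total x 1 with h | h
  · exact monotoneOn_polarFidelity hP hQ h Set.self_mem_Iic h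
  · exact antitoneOn_polarFidelity hP hQ Set.self_mem_Ici h h

end PolarFidelity

open PolarFidelity

theorem mainTheorem1 {d : ℕ} (P Q : Matrix (Fin d) (Fin d) ℂ) (hP : P.PosDef) (hQ : Q.PosDef) :
    -- both one-sided polar fidelities, and the Uhlmann fidelity, are real-valued
    ((∀ x : ℝ, (generalizedFidelity (P ^ x) P Q).im = 0) ∧
      (∀ x : ℝ, (generalizedFidelity (Q ^ x) P Q).im = 0) ∧
      (uhlmannFidelity P Q).im = 0) ∧
    -- two-range monotonicity of `x ↦ F_{P^x}(P, Q)`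
    (MonotoneOn (fun x : ℝ => (generalizedFidelity (P ^ x) P Q).re) (Set.Iic 1) ∧
      AntitoneOn (fun x : ℝ => (generalizedFidelity (P ^ x) P Q).re) (Set.Ici 1)) ∧
    -- two-range monotonicity of `x ↦ F_{Q^x}(P, Q)`
    (MonotoneOn (fun x : ℝ => (generalizedFidelity (Q ^ x) P Q).re) (Set.Iic 1) ∧
      AntitoneOn (fun x : ℝ => (generalizedFidelity (Q ^ x) P Q).re) (Set.Ici 1)) ∧
    -- the global maximum is the Uhlmann fidelity, attained at `x = 1`
    ((∀ x : ℝ, (generalizedFidelity (P ^ x) P Q).re ≤ (uhlmannFidelity P Q).re) ∧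
      generalizedFidelity (P ^ (1 : ℝ)) P Q = uhlmannFidelity P Q) ∧
    ((∀ x : ℝ, (generalizedFidelity (Q ^ x) P Q).re ≤ (uhlmannFidelity P Q).re) ∧
      generalizedFidelity (Q ^ (1 : ℝ)) P Q = uhlmannFidelity P Q) := by
  simp only [generalizedFidelity_rpow_left hP, generalizedFidelity_rpow_right hQ]
  have hPone : polarFidelity P Q 1 = uhlmannFidelity P Q := polarFidelity_one hP
  have hQone : polarFidelity Q P 1 = uhlmannFidelity P Q :=
    (polarFidelity_one hQ).trans (uhlmannFidelity_comm hP hQ).symm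
  refine ⟨⟨im_polarFidelity P Q, im_polarFidelity Q P, hPone ▸ im_polarFidelity P Q 1⟩,
    ⟨monotoneOn_polarFidelity hP hQ, antitoneOn_polarFidelity hP hQ⟩,
    ⟨monotoneOn_polarFidelity hQ hP, antitoneOn_polarFidelity hQ hP⟩,
    ⟨hPone ▸ re_polarFidelity_le_one hP hQ, hPone⟩,
    ⟨hQone ▸ re_polarFidelity_le_one hQ hP, hQone⟩⟩
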